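/- Let $G$ be a finite group (possibly non-abelian) with identity $e$, acting on a set $X$ (for instance by a linear representation on a vector space), and let $x\in X$. Let $k:X\times X\to\mathbb R$ be a kernel function, i.e. $k(p,q)=\langle\varphi(p),\varphi(q)\rangle$ for some map $\varphi$ into a real inner product space, that is $G$-stationary: $k(g.p,g.q)=k(p,q)$ for all $g\in G$, $p,q\in X$. Assume that the kernel matrix $K=(k(g.x,h.x))_{g,h\in G}$ is invertible, and let $y_{true}:G\to\mathbb C$ assign a label to each point $g.x$ of the orbit. Let $\kappa(h)=k(x,h.x)$ be the row of $K$ indexed by $e$. Let $\hat G$ be a set containing exactly one unitary irreducible matrix representation from each equivalence class; for $\sigma\in\hat G$ let $d_\sigma$ be its dimension and, for $f:G\to\mathbb C$, put $$\hat f_\sigma=\sqrt{\tfrac{d_\sigma}{|G|}}\sum_{g\in G}f(g)\,\sigma(g^{-1}).$$ Train kernel regression on the points $g.x$, $g\neq e$, with labels $y_{true}(g)$: its prediction at the missing point $x=e.x$ is $(K_T^{-1}k_T)^{\mathsf T}y_T$, where $K_T=(k(g.x,h.x))_{g,h\ne e}$, $k_T=(k(g.x,x))_{g\neq e}$, $y_T=(y_{true}(g))_{g\ne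 e}$. Let $\varepsilon$ be this prediction minus $y_{true}(e)$. Then $\hat G$ is finite, $K_T$ and all the matrices $\hat\kappa_\sigma$ are invertible, and the denominator below is non-zero. The number $\varepsilon$ is the most likely error: $z=\varepsilon$ is the unique maximizer over $z\in\mathbb C$ of $\exp(-\langle y,K^{-1}y\rangle)$ with $y=y_{true}+z\,\delta_e$, where $\delta_e(g)$ is $1$ for $g=e$ and $0$ otherwise. Moreover $$\varepsilon=-\frac{\sqrt{|G|}\,\sum_{\sigma\in\hat G}d_\sigma\,\mathrm{Tr}\big[\hat\kappa_\sigma^{-1}\,\hat y_{true,\sigma}\big]}{\sum_{\sigma\in\hat G}d_\sigma^{3/2}\,\mathrm{Tr}\big[\hat\kappa_\sigma^{-1}\big]},\qquad \overline{\varepsilon}=-\frac{\sqrt{|G|}\,\sum_{\sigma\in\hat G}d_\sigma\,\mathrm{Tr}\big[\hat\kappa_\sigma^{-1}\,\hat y_{true,\sigma}^{*}\big]}{\sum_{\sigma\in\hat G}d_\sigma^{3/2}\,\mathrm{Tr}\big[\hat\kappa_\sigma^{-1}\big]},$$ where $*$ denotes the conjugate transpose. In particular, if $y_{true}$ is real-valued,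 then $$\varepsilon=-\frac{\sqrt{|G|}\,\sum_{\sigma\in\hat G}d_\sigma\,\mathrm{Tr}\big[\hat\kappa_\sigma^{-1}\,\hat y_{true,\sigma}^{*}\big]}{\sum_{\sigma\in\hat G}d_\sigma^{3/2}\,\mathrm{Tr}\big[\hat\kappa_\sigma^{-1}\big]}.$$ -/

import Mathlib

open scoped Matrix

noncomputable section

namespace GroupKernel

/-! ### Kernels, kernel matrices and kernel regression -/

/-- `k` is the kernel function of the feature map `φ`, i.e. `k(p, q) = ⟨φ(p), φ(q)⟩`. -/
def IsFeatureMap {X H : Type*} [NormedAddCommGroup H] [InnerProductSpace ℝ H]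
    (k : X → X → ℝ) (φ : X → H) : Prop :=
  ∀ p q : X, k p q = inner ℝ (φ p) (φ q)

/-- `k` is stationary with respect to the action of `G` on `X`. -/
def IsStationary (G : Type*) {X : Type*} [Group G] [MulAction G X] (k : X → X → ℝ) : Prop :=
  ∀ (g : G) (p q : X), k (g • p) (g • q) = k p q

/-- The Gram matrix of `k` at the points `p t`. -/
def kernelMatrix {X T : Type*} (k : X → X → ℝ) (p : T → X) : Matrix T T ℝ :=
  Matrix.of fun s t => k (p s) (p t)

/-- The Gram matrix of `k` on the orbit of `x`, with entries `k(g.x, h.x)`. -/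
def orbitMatrix (G : Type*) {X : Type*} [Group G] [MulAction G X] (k : X → X → ℝ) (x : X) :
    Matrix G G ℝ :=
  kernelMatrix k fun g : G => g • x

/-- (Ridgeless) kernel regression with training points `p t` and labels `y t`, evaluated at the
point `q`: the number `(K⁻¹ k(p, q))ᵀ y`. -/
def kernelRegression {X T : Type*} [Fintype T] [DecidableEq T] (k : X → X → ℝ) (p : T → X)
    (y : T → ℂ) (q : X) : ℂ :=
  ∑ t, ((((kernelMatrix k p)⁻¹ *ᵥ fun s => k (p s) q) t : ℝ) : ℂ) * y t

/-- The point `g.x` of the orbit of `x`, for `g` different from the identity `e`. -/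
def trainPoint {G X : Type*} [Group G] [MulAction G X] (x : X) (g : {g : G // g ≠ 1}) : X :=
  (g : G) • x

/-- Prediction minus true label at the element `e`, for kernel regression trained on all points
`g.x`, `g ≠ e`, with labels `y g`. -/
def predictionError {G X : Type*} [Group G] [Fintype G] [DecidableEq G] [MulAction G X]
    (k : X → X → ℝ) (x : X) (y : G → ℂ) : ℂ :=
  kernelRegression k (trainPoint x) (fun g : {g : G // g ≠ 1} => y g) ((1 : G) • x) - y 1

/-- The unnormalized Gaussian likelihood `exp(-⟨y, K⁻¹ y⟩)` with covariance `K`. -/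
def likelihood {T : Type*} [Fintype T] [DecidableEq T] (K : Matrix T T ℝ) (y : T → ℂ) : ℝ :=
  Real.exp (-(star y ⬝ᵥ ((K⁻¹).map (fun r : ℝ => (r : ℂ)) *ᵥ y)).re)

/-! ### Unitary irreps and generalized Fourier coefficients -/

/-- The linear representation on `ℂᵈ` given by a homomorphism into the unitary group. -/
def unitaryRepresentation {G : Type*} [Group G] {d : ℕ}
    (ρ : G →* Matrix.unitaryGroup (Fin d) ℂ) : Representation ℂ G (Fin d → ℂ) :=
  ((Matrix.toLinAlgEquiv' : Matrix (Fin d) (Fin d) ℂ ≃ₐ[ℂ] _) :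
      Matrix (Fin d) (Fin d) ℂ →* ((Fin d → ℂ) →ₗ[ℂ] (Fin d → ℂ))).comp
    ((Matrix.unitaryGroup (Fin d) ℂ).subtype.comp ρ)

/-- A unitary irreducible matrix representation of `G`. -/
structure UnitaryIrrep (G : Type*) [Group G] where
  /-- the dimension -/
  dim : ℕ
  /-- the unitary matrices -/
  toHom : G →* Matrix.unitaryGroup (Fin dim) ℂ
  irreducible : (unitaryRepresentation toHom).IsIrreducible

/-- The matrix `σ(g)`. -/
def UnitaryIrrep.mat {G : Type*} [Group G] (σ : UnitaryIrrep G) (g : G) :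
    Matrix (Fin σ.dim) (Fin σ.dim) ℂ :=
  (σ.toHom g : Matrix (Fin σ.dim) (Fin σ.dim) ℂ)

/-- Equivalence of unitary irreps. -/
def UnitaryIrrep.Equivalent {G : Type*} [Group G] (σ τ : UnitaryIrrep G) : Prop :=
  Nonempty ((unitaryRepresentation σ.toHom).Equiv (unitaryRepresentation τ.toHom))

/-- The family `σ` contains exactly one member of every equivalence class of unitary irreps of
`G`, so its index set is a copy of the dual `Ĝ`. -/
def IsDual {G ι : Type*} [Group G] (σ : ι → UnitaryIrrep G) : Prop :=
  ∀ τ : UnitaryIrrep G, ∃! i : ι, (σ i).Equivalent τ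

/-- The generalized Fourier coefficient `√(d_σ / |G|) ∑ g, f(g) σ(g⁻¹)` (orthogonal convention). -/
def fourierCoeff {G : Type*} [Group G] [Fintype G] (f : G → ℂ) (σ : UnitaryIrrep G) :
    Matrix (Fin σ.dim) (Fin σ.dim) ℂ :=
  ((Real.sqrt ((σ.dim : ℝ) / (Fintype.card G : ℝ)) : ℝ) : ℂ) • ∑ g : G, f g • σ.mat g⁻¹

/-- The Fourier coefficient at `σ` of the row of the orbit matrix indexed by `e`, that is, of the
function `κ(h) = k(e.x, h.x)`. -/
def kernelCoeff {G X : Type*} [Group G] [Fintype G] [MulAction G X] (k : X → X → ℝ) (x : X)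
    (σ : UnitaryIrrep G) : Matrix (Fin σ.dim) (Fin σ.dim) ℂ :=
  fourierCoeff (fun h : G => ((orbitMatrix G k x 1 h : ℝ) : ℂ)) σ

end GroupKernel

end

/-!
The kernel matrix `K` is a Gram matrix, so being invertible it is positive definite, and `Q = K⁻¹` is
positive definite too. Leaving out the point `e`, the regression weights `w` solve the regression
equation exactly when `K` maps `δ_e - w` to a multiple of `δ_e`; hence `δ_e - w` is proportional to
the `e`-th column of `Q`, and the error is `ε = -(Q y)(e) / Q(e, e)`
(`GroupKernel.predictionError_eq`). Equivalently `Q (y + ε δ_e)` vanishes at `e`, which by completing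
the square says that `ε` is the unique minimizer of the quadratic form
(`GroupKernel.likelihood_add_single_lt`).

By stationarity `K(g, h) = κ(g⁻¹h)` and `Q(g, h) = q(g⁻¹h)` are convolution matrices, with `q` the row
of `Q` indexed by `e`. The unnormalized Fourier transform `f ↦ ∑ f(g) σ(g⁻¹)` turns convolution into
matrix multiplication, so the coefficient of `q` inverts that of `κ` (`GroupKernel.kernelCoeff_inv`).
Weighted sums of traces are evaluated with the regular character
`∑ d_σ χ_σ = |G| δ_e` (`GroupKernel.IsDual.sum_dim_mul_trace`): the numerator and denominator of the
formula become the same multiple of `(Q y)(e)` and `Q(e, e)`.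

The regular character is obtained from two facts about unitary irreps. Schur's lemma, applied to
averaged matrix units, gives `∑ χ_σ(g⁻¹) τ(g) = 0` for inequivalent `σ`, `τ` and `(|G| / d_σ) • 1` for
`τ = σ`; it also makes the characters linearly independent, whence the dual is finite. Moreover the
Fourier transform is injective (`GroupKernel.fourierKernel_eq_bot`): the functions orthogonal to all
matrix coefficients form a right-translation-invariant subspace of `ℓ²(G)`, and an irreducible
subspace of it would itself consist of matrix coefficients. Both sides of the claimed identity have
the same Fourier transform.
-/

open scoped Matrix

noncomputable section

namespace GroupKernel

/-! ### Leaving one point out of a positive definite kernel matrix -/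

/-- If `v` is the vector with `v a = 1` and `v t = -w t` elsewhere, where `w` solves the regression
equation, then `K v` is a multiple of the `a`-th unit vector, so `v` is proportional to the column
`a` of `K⁻¹`. -/
lemma regressionWeights_eq {T : Type*} [Fintype T] [DecidableEq T] {K : Matrix T T ℝ}
    (hK : K.PosDef) (a : T) (t : {t : T // t ≠ a}) :
    ((K.submatrix (Subtype.val : {t : T // t ≠ a} → T) Subtype.val)⁻¹ *ᵥ fun s : {t : T // t ≠ a} => K s a) t =
      -(K⁻¹ t a) / K⁻¹ a a := by
  set M := K.submatrix (Subtype.val : {t : T // t ≠ a} → T) Subtype.val with hM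
  have hMu : IsUnit M.det :=
    (Matrix.isUnit_iff_isUnit_det _).1 (hK.submatrix Subtype.val_injective).isUnit
  have hKu : IsUnit K.det := (Matrix.isUnit_iff_isUnit_det _).1 hK.isUnit
  set w : {t : T // t ≠ a} → ℝ := M⁻¹ *ᵥ fun s => K (s : T) a with hw
  have hMw : M *ᵥ w = fun s : {t : T // t ≠ a} => K s a := by
    rw [hw, Matrix.mulVec_mulVec, Matrix.mul_nonsing_inv _ hMu, Matrix.one_mulVec]
  let v : T → ℝ := fun t => if h : t = a then 1 else -w ⟨t, h⟩
  have hva : v a = 1 := by simp [v]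
  have hvt : ∀ t : {t : T // t ≠ a}, v t = -w t := fun t => by simp [v, t.2]
  have hKv : ∃ c : ℝ, K *ᵥ v = Pi.single a c := by
    refine ⟨(K *ᵥ v) a, funext fun s => ?_⟩
    by_cases hs : s = a
    · subst hs; simp
    · have h := congrFun hMw ⟨s, hs⟩
      simp only [Matrix.mulVec, dotProduct, hM, Matrix.submatrix_apply] at h
      rw [Pi.single_eq_of_ne hs, Matrix.mulVec, dotProduct,
        Fintype.sum_eq_add_sum_subtype_ne _ a]
      simp only [hva, hvt, mul_neg, Finset.sum_neg_distrib, h]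
      ring
  obtain ⟨c, hc⟩ := hKv
  have hv : v = K⁻¹ *ᵥ Pi.single a c := by
    rw [← hc, Matrix.mulVec_mulVec, Matrix.nonsing_inv_mul _ hKu, Matrix.one_mulVec]
  have hv' : ∀ t, v t = K⁻¹ t a * c := fun t => by rw [hv]; simp [Matrix.mulVec_single]
  have h1 : K⁻¹ a a * c = 1 := by rw [← hv', hva]
  have h2 : -w t = K⁻¹ t a * c := by rw [← hvt, hv']
  have h3 : K⁻¹ a a ≠ 0 := left_ne_zero_of_mul_eq_one h1
  rw [eq_div_iff h3]
  linear_combination (-K⁻¹ a a) * h2 - K⁻¹ t a * h1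

/-- Completing the square: along the line `u + z δₐ`, a Hermitian form is smallest where the
`a`-th coordinate of `Q u` vanishes. -/
lemma likelihood_add_single_lt {T : Type*} [Fintype T] [DecidableEq T] {K : Matrix T T ℝ}
    (hK : K.PosDef) (a : T) (u : T → ℂ)
    (hu : ((K⁻¹.map (fun r : ℝ => (r : ℂ))) *ᵥ u) a = 0) {z : ℂ} (hz : z ≠ 0) :
    likelihood K (u + Pi.single a z) < likelihood K u := by
  set Q : Matrix T T ℂ := K⁻¹.map (fun r : ℝ => (r : ℂ)) with hQ
  have hpos : 0 < K⁻¹ a a := hK.inv.diag_pos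
  have hherm : Qᴴ = Q := by
    ext i j
    have h := congrFun (congrFun hK.inv.isHermitian.eq i) j
    simp only [Matrix.conjTranspose_apply, star_trivial] at h
    simp [hQ, h]
  have h1 : star u ⬝ᵥ (Q *ᵥ Pi.single a z) = 0 := by
    rw [Matrix.dotProduct_mulVec, ← hherm, ← Matrix.star_mulVec, dotProduct_single, Pi.star_apply,
      hu, star_zero, zero_mul]
  have h2 : star (Pi.single a z : T → ℂ) ⬝ᵥ (Q *ᵥ u) = 0 := by
    rw [Pi.star_single, single_dotProduct, hu, mul_zero]
  have h3 : star (Pi.single a z : T → ℂ) ⬝ᵥ (Q *ᵥ Pi.single a z) =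
      ((K⁻¹ a a * Complex.normSq z : ℝ) : ℂ) := by
    rw [Pi.star_single, single_dotProduct, Matrix.mulVec, dotProduct_single, Complex.ofReal_mul,
      Complex.normSq_eq_conj_mul_self]
    simp only [hQ, Matrix.map_apply, RCLike.star_def]
    ring
  unfold likelihood
  rw [Real.exp_lt_exp, neg_lt_neg_iff, ← hQ, star_add, Matrix.mulVec_add, dotProduct_add,
    add_dotProduct, add_dotProduct, h1, h2, h3, zero_add, add_zero, Complex.add_re,
    Complex.ofReal_re]
  exact lt_add_of_pos_right _ (mul_pos hpos (Complex.normSq_pos.2 hz))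

lemma orbitMatrix_mul_left {G X : Type*} [Group G] [MulAction G X] {k : X → X → ℝ} {x : X}
    (hk : IsStationary G k) (g a b : G) :
    orbitMatrix G k x (g * a) (g * b) = orbitMatrix G k x a b := by
  simp [orbitMatrix, kernelMatrix, mul_smul, hk g]

section Orbit

variable {G X H : Type*} [Group G] [Fintype G] [DecidableEq G] [MulAction G X]
  [NormedAddCommGroup H] [InnerProductSpace ℝ H] {k : X → X → ℝ} {φ : X → H} {x : X}

lemma orbitMatrix_posDef (hφ : IsFeatureMap k φ) (hK : IsUnit (orbitMatrix G k x)) :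
    (orbitMatrix G k x).PosDef := by
  have h : orbitMatrix G k x = Matrix.gram ℝ fun g : G => φ (g • x) := by
    ext g h
    simp [orbitMatrix, kernelMatrix, hφ _ _, Matrix.gram]
  have hps : (orbitMatrix G k x).PosSemidef := h ▸ Matrix.posSemidef_gram ℝ _
  exact hps.posDef_iff_isUnit.2 hK

lemma kernelMatrix_trainPoint_isUnit (hK : (orbitMatrix G k x).PosDef) :
    IsUnit (kernelMatrix k (trainPoint (G := G) x)) :=
  (hK.submatrix (Subtype.val_injective : Function.Injective
    (Subtype.val : {g : G // g ≠ 1} → G))).isUnit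

/-- The error is `-(K⁻¹ y)(e) / K⁻¹(e, e)`. -/
lemma predictionError_eq (hK : (orbitMatrix G k x).PosDef) (y : G → ℂ) :
    predictionError k x y =
      -(∑ g, (((orbitMatrix G k x)⁻¹ g 1 : ℝ) : ℂ) * y g) / ((orbitMatrix G k x)⁻¹ 1 1 : ℝ) := by
  have hpos : ((orbitMatrix G k x)⁻¹ 1 1 : ℝ) ≠ 0 := hK.inv.diag_pos.ne'
  have hpos' : (((orbitMatrix G k x)⁻¹ 1 1 : ℝ) : ℂ) ≠ 0 := by exact_mod_cast hpos
  have h : ∀ t : {g : G // g ≠ 1}, ((kernelMatrix k (trainPoint (G := G) x))⁻¹ *ᵥ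
      fun s => k (trainPoint x s) ((1 : G) • x)) t =
      -((orbitMatrix G k x)⁻¹ t 1) / (orbitMatrix G k x)⁻¹ 1 1 :=
    fun t => regressionWeights_eq hK 1 t
  unfold predictionError kernelRegression
  simp only [h]
  rw [Fintype.sum_eq_add_sum_subtype_ne _ (1 : G), eq_div_iff hpos', sub_mul, Finset.sum_mul,
    neg_add, ← Finset.sum_neg_distrib, sub_eq_neg_add, mul_comm (y 1)]
  congr 1
  refine Finset.sum_congr rfl fun t _ => ?_
  push_cast
  field_simp

lemma orbitMatrix_inv_comm (hK : (orbitMatrix G k x).PosDef) (g h : G) :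
    (orbitMatrix G k x)⁻¹ g h = (orbitMatrix G k x)⁻¹ h g := by
  have h := congrFun (congrFun hK.inv.isHermitian.eq g) h
  simpa using h.symm

lemma likelihood_predictionError (hK : (orbitMatrix G k x).PosDef) (y : G → ℂ) (z : ℂ)
    (hz : z ≠ predictionError k x y) :
    likelihood (orbitMatrix G k x) (y + Pi.single 1 z) <
      likelihood (orbitMatrix G k x) (y + Pi.single 1 (predictionError k x y)) := by
  have hpos' : (((orbitMatrix G k x)⁻¹ 1 1 : ℝ) : ℂ) ≠ 0 := by
    exact_mod_cast (hK.inv.diag_pos (i := (1 : G))).ne'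
  have hu : (((orbitMatrix G k x)⁻¹.map (fun r : ℝ => (r : ℂ))) *ᵥ
      (y + Pi.single 1 (predictionError k x y))) 1 = 0 := by
    rw [Matrix.mulVec_add, Pi.add_apply, Matrix.mulVec, Matrix.mulVec, dotProduct_single,
      predictionError_eq hK, Matrix.map_apply, mul_div_cancel₀ _ hpos', dotProduct]
    simp [orbitMatrix_inv_comm hK 1]
  have h := likelihood_add_single_lt hK 1 _ hu (sub_ne_zero.2 hz)
  rwa [add_assoc, ← Pi.single_add, add_sub_cancel] at h

end Orbit

/-! ### Schur orthogonality for unitary irreps -/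

namespace UnitaryIrrep

variable {G : Type*} [Group G]

lemma mat_mul (σ : UnitaryIrrep G) (g h : G) : σ.mat (g * h) = σ.mat g * σ.mat h := by
  simp [mat]

lemma mat_one (σ : UnitaryIrrep G) : σ.mat 1 = 1 := by
  simp [mat]

lemma mat_inv (σ : UnitaryIrrep G) (g : G) : σ.mat g⁻¹ = (σ.mat g)ᴴ := by
  simp [mat, Matrix.star_eq_conjTranspose]

lemma unitaryRepresentation_apply (σ : UnitaryIrrep G) (g : G) (v : Fin σ.dim → ℂ) :
    unitaryRepresentation σ.toHom g v = σ.mat g *ᵥ v := by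
  simp [unitaryRepresentation, mat]

lemma dim_pos (σ : UnitaryIrrep G) : 0 < σ.dim := by
  obtain ⟨d, ρ, h⟩ := σ
  rcases Nat.eq_zero_or_pos d with rfl | hd
  · obtain ⟨S, T, hST⟩ := h.exists_pair_ne
    have hzero : ∀ (U : Subrepresentation (unitaryRepresentation ρ)) (v : Fin 0 → ℂ), v ∈ U :=
      fun U v => Subsingleton.elim 0 v ▸ U.toSubmodule.zero_mem
    exact absurd (SetLike.ext fun v => iff_of_true (hzero S v) (hzero T v)) hST
  · exact hd

/-- A matrix intertwining two irreps, as a morphism of representations. -/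
def intertwiner {σ τ : UnitaryIrrep G} (A : Matrix (Fin τ.dim) (Fin σ.dim) ℂ)
    (hA : ∀ g, A * σ.mat g = τ.mat g * A) :
    (unitaryRepresentation σ.toHom).IntertwiningMap (unitaryRepresentation τ.toHom) where
  toLinearMap := A.mulVecLin
  isIntertwining' g := by
    refine LinearMap.ext fun v => ?_
    rw [LinearMap.comp_apply, LinearMap.comp_apply, unitaryRepresentation_apply,
      unitaryRepresentation_apply, Matrix.mulVecLin_apply, Matrix.mulVecLin_apply,
      Matrix.mulVec_mulVec, Matrix.mulVec_mulVec, hA]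

lemma intertwiner_eq_zero {σ τ : UnitaryIrrep G} (hστ : ¬ σ.Equivalent τ)
    (A : Matrix (Fin τ.dim) (Fin σ.dim) ℂ) (hA : ∀ g, A * σ.mat g = τ.mat g * A) : A = 0 := by
  have := σ.irreducible
  have := τ.irreducible
  rcases Representation.IsIrreducible.bijective_or_eq_zero (intertwiner A hA) with h | h
  · exact absurd ⟨(intertwiner A hA).ofBijective h⟩ hστ
  · have h' : A.mulVecLin = 0 := congrArg (fun f => f.toLinearMap) h
    apply Matrix.toLin'.injective
    rw [Matrix.toLin'_apply', h', map_zero]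

lemma intertwiner_eq_smul_one {σ : UnitaryIrrep G}
    (A : Matrix (Fin σ.dim) (Fin σ.dim) ℂ) (hA : ∀ g, A * σ.mat g = σ.mat g * A) :
    ∃ c : ℂ, A = c • 1 := by
  have := σ.irreducible
  obtain ⟨c, hc⟩ := Representation.IsIrreducible.algebraMap_intertwiningMap_bijective_of_isAlgClosed.2
    (intertwiner A hA)
  refine ⟨c, ?_⟩
  have h' : A.mulVecLin = c • LinearMap.id := (congrArg (fun f => f.toLinearMap) hc).symm
  apply Matrix.toLin'.injective
  rw [Matrix.toLin'_apply', h', map_smul, Matrix.toLin'_one]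

lemma Equivalent.exists_matrix {σ τ : UnitaryIrrep G} (h : σ.Equivalent τ) :
    ∃ (P : Matrix (Fin τ.dim) (Fin σ.dim) ℂ) (Q : Matrix (Fin σ.dim) (Fin τ.dim) ℂ),
      ∀ g, τ.mat g = P * σ.mat g * Q := by
  obtain ⟨e⟩ := h
  refine ⟨LinearMap.toMatrix' (e.toLinearEquiv : _ →ₗ[ℂ] _),
    LinearMap.toMatrix' (e.toLinearEquiv.symm : _ →ₗ[ℂ] _), fun g => ?_⟩
  have h := fun v => e.toIntertwiningMap.isIntertwining _ _ g v
  apply Matrix.toLin'.injective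
  refine LinearMap.ext fun v => ?_
  have hg := h (e.toLinearEquiv.symm v)
  rw [unitaryRepresentation_apply, unitaryRepresentation_apply] at hg
  rw [Matrix.toLin'_mul, Matrix.toLin'_mul, Matrix.toLin'_toMatrix', Matrix.toLin'_toMatrix',
    LinearMap.comp_apply, LinearMap.comp_apply, Matrix.toLin'_apply, Matrix.toLin'_apply]
  have hv : e.toIntertwiningMap (e.toLinearEquiv.symm v) = v := e.toLinearEquiv.apply_symm_apply v
  rw [hv] at hg
  exact hg.symm

variable [Fintype G]

/-- Averaging any matrix over the group gives an intertwiner, to which Schur's lemma applies. -/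
lemma average_intertwines (σ τ : UnitaryIrrep G) (A : Matrix (Fin τ.dim) (Fin σ.dim) ℂ) (h : G) :
    (∑ g, τ.mat g * A * σ.mat g⁻¹) * σ.mat h = τ.mat h * ∑ g, τ.mat g * A * σ.mat g⁻¹ := by
  rw [← Equiv.sum_comp (Equiv.mulLeft h) fun g => τ.mat g * A * σ.mat g⁻¹, Matrix.sum_mul,
    Equiv.sum_comp (Equiv.mulLeft h) fun g => τ.mat g * A * σ.mat g⁻¹, Matrix.mul_sum]
  refine Finset.sum_congr rfl fun g _ => ?_
  simp only [Equiv.coe_mulLeft, mat_mul, mul_inv_rev, Matrix.mul_assoc]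
  rw [← mat_mul, inv_mul_cancel, mat_one, Matrix.mul_one]

/-- Averaging a matrix unit isolates the pairing of two matrix coefficients. -/
lemma sum_mat_mul_single_mul_mat {σ τ : UnitaryIrrep G} (a : Fin σ.dim) (b : Fin τ.dim)
    (c : Fin τ.dim) (d : Fin σ.dim) :
    (∑ g, τ.mat g * Matrix.single b a (1 : ℂ) * σ.mat g⁻¹) c d =
      ∑ g, τ.mat g c b * σ.mat g⁻¹ a d := by
  rw [Matrix.sum_apply]
  refine Finset.sum_congr rfl fun g _ => ?_
  rw [Matrix.mul_assoc, Matrix.mul_apply, Finset.sum_eq_single b]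
  · simp
  · intro j _ hj
    rw [Matrix.single_mul_apply_of_ne _ _ _ _ _ hj, mul_zero]
  · simp

lemma sum_trace_smul_mat_of_not_equivalent {σ τ : UnitaryIrrep G} (hστ : ¬ σ.Equivalent τ) :
    ∑ g, (σ.mat g⁻¹).trace • τ.mat g = 0 := by
  ext c d
  rw [Matrix.sum_apply]
  simp only [Matrix.smul_apply, smul_eq_mul, Matrix.trace, Matrix.diag_apply, Finset.sum_mul]
  rw [Finset.sum_comm]
  refine Finset.sum_eq_zero fun a _ => ?_
  have h := sum_mat_mul_single_mul_mat (σ := σ) (τ := τ) a d c a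
  rw [intertwiner_eq_zero hστ _ (average_intertwines σ τ _)] at h
  simpa [mul_comm] using h.symm

lemma sum_trace_smul_mat_self (σ : UnitaryIrrep G) :
    ∑ g, (σ.mat g⁻¹).trace • σ.mat g = ((Fintype.card G : ℂ) / σ.dim) • 1 := by
  have hd : (σ.dim : ℂ) ≠ 0 := by exact_mod_cast σ.dim_pos.ne'
  ext c d
  rw [Matrix.sum_apply]
  simp only [Matrix.smul_apply, smul_eq_mul, Matrix.trace, Matrix.diag_apply, Finset.sum_mul]
  rw [Finset.sum_comm]
  -- The average of the matrix unit `E_{da}` is a scalar, found by comparing traces.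
  have key : ∀ a, ∑ g, σ.mat g⁻¹ a a * σ.mat g c d =
      if a = d then (if c = a then (Fintype.card G : ℂ) / σ.dim else 0) else 0 := by
    intro a
    obtain ⟨r, hr⟩ := intertwiner_eq_smul_one _ (average_intertwines σ σ (Matrix.single d a (1 : ℂ)))
    have ht := congrArg Matrix.trace hr
    have h1 : ∀ g, (σ.mat g * Matrix.single d a (1 : ℂ) * σ.mat g⁻¹).trace =
        if a = d then 1 else 0 := by
      intro g
      rw [Matrix.trace_mul_comm, ← Matrix.mul_assoc, ← mat_mul, inv_mul_cancel, mat_one,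
        Matrix.one_mul]
      split_ifs with h
      · subst h; simp
      · exact Matrix.trace_single_eq_of_ne _ _ _ (Ne.symm h)
    rw [Matrix.trace_sum] at ht
    simp only [h1] at ht
    have h := sum_mat_mul_single_mul_mat (σ := σ) (τ := σ) a d c a
    rw [hr] at h
    simp only [mul_comm (σ.mat _ c d)] at h
    rw [← h]
    simp only [Finset.sum_const, Finset.card_univ, nsmul_eq_mul, Matrix.trace_smul,
      Matrix.trace_one, Fintype.card_fin, smul_eq_mul] at ht
    have hr' : r = (if a = d then (Fintype.card G : ℂ) / σ.dim else 0) := by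
      rw [eq_comm] at ht
      rw [← mul_left_inj' hd, ht]
      split_ifs
      · field_simp
      · simp
    rw [hr']
    simp only [Matrix.smul_apply, Matrix.one_apply, smul_eq_mul]
    split_ifs <;> simp
  simp only [key]
  simp [Matrix.one_apply]

end UnitaryIrrep

/-! ### Unitary irreps inside unitary representations -/

lemma exists_minimal_invariant {G E : Type*} [Group G] [AddCommGroup E] [Module ℂ E]
    [FiniteDimensional ℂ E] (R : Representation ℂ G E) (U : Submodule ℂ E) (hU0 : U ≠ ⊥)
    (hU : ∀ g, ∀ v ∈ U, R g v ∈ U) :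
    ∃ V : Submodule ℂ E, V ≤ U ∧ V ≠ ⊥ ∧ (∀ g, ∀ v ∈ V, R g v ∈ V) ∧
      ∀ W ≤ V, W ≠ ⊥ → (∀ g, ∀ v ∈ W, R g v ∈ W) → W = V := by
  obtain ⟨V, ⟨hVU, hV0, hV⟩, hmin⟩ := exists_minimal_of_wellFoundedLT
    (fun V : Submodule ℂ E => V ≤ U ∧ V ≠ ⊥ ∧ ∀ g, ∀ v ∈ V, R g v ∈ V) ⟨U, le_rfl, hU0, hU⟩
  exact ⟨V, hVU, hV0, hV, fun W hWV hW0 hW =>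
    le_antisymm hWV (hmin ⟨hWV.trans hVU, hW0, hW⟩ hWV)⟩

/-- Every nonzero invariant subspace of a finite-dimensional unitary representation contains an
irreducible one, and an orthonormal basis of it turns the action into a unitary irrep. -/
lemma exists_unitaryIrrep {G E : Type*} [Group G] [NormedAddCommGroup E] [InnerProductSpace ℂ E]
    [FiniteDimensional ℂ E] (R : Representation ℂ G E)
    (hR : ∀ g v w, inner ℂ (R g v) (R g w) = inner ℂ v w) (U : Submodule ℂ E) (hU0 : U ≠ ⊥)
    (hU : ∀ g, ∀ v ∈ U, R g v ∈ U) :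
    ∃ (τ : UnitaryIrrep G) (b : Fin τ.dim → E), Orthonormal ℂ b ∧ (∀ j, b j ∈ U) ∧
      ∀ g j, R g (b j) = ∑ i, τ.mat g i j • b i := by
  obtain ⟨V, hVU, hV0, hV, hmin⟩ := exists_minimal_invariant R U hU0 hU
  set d := Module.finrank ℂ V
  let e : OrthonormalBasis (Fin d) ℂ V := stdOrthonormalBasis ℂ V
  let b : Fin d → E := fun i => (e i : E)
  have hb : Orthonormal ℂ b := e.orthonormal.comp_linearIsometry V.subtypeₗᵢ
  let M : G → Matrix (Fin d) (Fin d) ℂ := fun g => Matrix.of fun i j => inner ℂ (b i) (R g (b j))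
  have hexp : ∀ v ∈ V, v = ∑ i, inner ℂ (b i) v • b i := by
    intro v hv
    have h := congrArg (Subtype.val : V → E) (e.sum_repr' ⟨v, hv⟩).symm
    simpa [b] using h
  have hM : ∀ g j, R g (b j) = ∑ i, M g i j • b i := fun g j => hexp _ (hV g _ (e j).2)
  have hMmul : ∀ g h, M (g * h) = M g * M h := by
    intro g h
    ext i j
    rw [Matrix.mul_apply]
    change inner ℂ (b i) (R (g * h) (b j)) = _
    rw [map_mul, Module.End.mul_apply, hM h j, map_sum, inner_sum]
    refine Finset.sum_congr rfl fun l _ => ?_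
    rw [map_smul, inner_smul_right, mul_comm]
    rfl
  have hM1 : M 1 = 1 := by
    ext i j
    simp only [M, Matrix.of_apply, map_one, Module.End.one_apply]
    rw [orthonormal_iff_ite.1 hb, Matrix.one_apply]
  have hMu : ∀ g, M g ∈ Matrix.unitaryGroup (Fin d) ℂ := by
    intro g
    rw [Matrix.mem_unitaryGroup_iff']
    ext i j
    have h1 : inner ℂ (R g (b i)) (R g (b j)) = (1 : Matrix (Fin d) (Fin d) ℂ) i j := by
      rw [hR, orthonormal_iff_ite.1 hb, Matrix.one_apply]
    rw [← h1, hM g i, sum_inner, Matrix.mul_apply]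
    refine Finset.sum_congr rfl fun l _ => ?_
    rw [inner_smul_left]
    rfl
  let ρ : G →* Matrix.unitaryGroup (Fin d) ℂ :=
    { toFun := fun g => ⟨M g, hMu g⟩
      map_one' := Subtype.ext hM1
      map_mul' := fun g h => Subtype.ext (hMmul g h) }
  have hρ : ∀ g v, unitaryRepresentation ρ g v = M g *ᵥ v := fun g v => by
    simp [unitaryRepresentation, ρ]
  let L : (Fin d → ℂ) →ₗ[ℂ] E := Fintype.linearCombination ℂ b
  have hL : ∀ c, L c = ∑ i, c i • b i := fun c => rfl
  have hLinj : Function.Injective L := hb.linearIndependent.fintypeLinearCombination_injective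
  have hLV : ∀ c, L c ∈ V := fun c => (hL c).symm ▸ V.sum_mem fun i _ => V.smul_mem _ (e i).2
  have hVL : ∀ v ∈ V, ∃ c, L c = v := fun v hv => ⟨fun i => inner ℂ (b i) v, (hexp v hv).symm⟩
  have hLR : ∀ g c, L (M g *ᵥ c) = R g (L c) := by
    intro g c
    simp only [hL, map_sum, map_smul, hM, Finset.smul_sum, Matrix.mulVec, dotProduct,
      Finset.sum_smul, smul_smul]
    rw [Finset.sum_comm]
    simp only [mul_comm]
  have hirr : (unitaryRepresentation ρ).IsIrreducible := by
    refine { exists_pair_ne := ⟨⊥, ⊤, ?_⟩, eq_bot_or_eq_top := ?_ }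
    · intro h
      obtain ⟨v, hv, hv0⟩ := V.ne_bot_iff.1 hV0
      obtain ⟨c, rfl⟩ := hVL v hv
      have hc : c ∈ (⊥ : Subrepresentation (unitaryRepresentation ρ)) := by
        rw [h]; exact Submodule.mem_top (R := ℂ)
      have hc0 : c = 0 := hc
      exact hv0 (by rw [hc0, map_zero])
    · intro S
      by_cases hS : S.toSubmodule.map L = ⊥
      · left
        refine Subrepresentation.toSubmodule_injective ?_
        exact Submodule.map_injective_of_injective hLinj (hS.trans (Submodule.map_bot L).symm)
      · right
        have hSV : S.toSubmodule.map L = V := by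
          refine hmin _ ?_ hS ?_
          · rintro _ ⟨c, -, rfl⟩
            exact hLV c
          · rintro g _ ⟨c, hc, rfl⟩
            refine ⟨M g *ᵥ c, ?_, hLR g c⟩
            rw [← hρ]
            exact S.apply_mem_toSubmodule g hc
        refine SetLike.ext fun c => iff_of_true ?_ (Submodule.mem_top (R := ℂ))
        have hc : L c ∈ S.toSubmodule.map L := hSV ▸ hLV c
        obtain ⟨c', hc', h⟩ := hc
        rw [← hLinj h]
        exact hc'
  exact ⟨⟨d, ρ, hirr⟩, b, hb, fun j => hVU (e j).2, hM⟩

/-! ### Injectivity of the Fourier transform and the regular character -/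

section

variable {G : Type*} [Group G]

lemma IsDual.not_equivalent {ι : Type*} {σ : ι → UnitaryIrrep G} (hσ : IsDual σ) {i j : ι}
    (hij : i ≠ j) : ¬ (σ i).Equivalent (σ j) :=
  fun h => hij ((hσ (σ j)).unique h ⟨Representation.Equiv.refl _⟩)

variable [Fintype G]

/-- Right translation on `ℓ²(G)`. -/
def rightTranslation (G : Type*) [Group G] [Fintype G] :
    Representation ℂ G (EuclideanSpace ℂ G) where
  toFun g :=
    { toFun := fun f => WithLp.toLp 2 fun h => f (h * g)
      map_add' := fun _ _ => rfl
      map_smul' := fun _ _ => rfl }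
  map_one' := by ext f h; simp
  map_mul' g g' := by
    ext f h
    exact congrArg f (mul_assoc h g g').symm

lemma rightTranslation_apply (g : G) (f : EuclideanSpace ℂ G) (h : G) :
    rightTranslation G g f h = f (h * g) := rfl

lemma inner_rightTranslation (g : G) (f f' : EuclideanSpace ℂ G) :
    inner ℂ (rightTranslation G g f) (rightTranslation G g f') = inner ℂ f f' := by
  simp only [PiLp.inner_apply, rightTranslation_apply]
  exact Equiv.sum_comp (Equiv.mulRight g) fun h => inner ℂ (f h) (f' h)

/-- The functions orthogonal to all matrix coefficients of unitary irreps. -/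
def fourierKernel (G : Type*) [Group G] [Fintype G] : Submodule ℂ (EuclideanSpace ℂ G) where
  carrier := {f | ∀ τ : UnitaryIrrep G, ∑ h, star (f h) • τ.mat h = 0}
  zero_mem' τ := by simp
  add_mem' {f f'} hf hf' τ := by
    simp only [PiLp.add_apply, star_add, add_smul, Finset.sum_add_distrib]
    rw [hf τ, hf' τ, add_zero]
  smul_mem' c f hf τ := by
    have h : ∀ h, star ((c • f) h) • τ.mat h = star c • (star (f h) • τ.mat h) := fun h => by
      rw [PiLp.smul_apply, smul_eq_mul, star_mul', mul_smul]
    simp only [h, ← Finset.smul_sum, hf τ, smul_zero]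

lemma rightTranslation_mem_fourierKernel (g : G) {f : EuclideanSpace ℂ G}
    (hf : f ∈ fourierKernel G) : rightTranslation G g f ∈ fourierKernel G := by
  intro τ
  have h := congrArg (· * τ.mat g⁻¹) (hf τ)
  simp only [zero_mul, Matrix.sum_mul, Matrix.smul_mul, ← UnitaryIrrep.mat_mul] at h
  rw [← h, ← Equiv.sum_comp (Equiv.mulRight g) fun h => star (f h) • τ.mat (h * g⁻¹)]
  simp [rightTranslation_apply]

/-- An irreducible subspace of `fourierKernel G` would consist of matrix coefficients of a unitary
irrep, hence of functions orthogonal to themselves. -/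
lemma fourierKernel_eq_bot : fourierKernel G = ⊥ := by
  by_contra hne
  obtain ⟨τ, b, hb, hbN, hτ⟩ := exists_unitaryIrrep (rightTranslation G) inner_rightTranslation
    (fourierKernel G) hne fun g v hv => rightTranslation_mem_fourierKernel g hv
  let j : Fin τ.dim := ⟨0, τ.dim_pos⟩
  -- Evaluating the translates of `b j` at `1` exhibits `b j` as a combination of matrix coefficients.
  have hcoef : ∀ g, b j g = ∑ i, τ.mat g i j * b i 1 := by
    intro g
    have h := congrArg (fun f : EuclideanSpace ℂ G => f 1) (hτ g j)
    simpa [rightTranslation_apply] using h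
  have horth : ∀ i, ∑ h, star (b j h) * τ.mat h i j = 0 := by
    intro i
    have h := congrFun (congrFun (hbN j τ) i) j
    simpa [Matrix.sum_apply] using h
  have h0 : inner ℂ (b j) (b j) = (0 : ℂ) := by
    rw [PiLp.inner_apply]
    calc ∑ h, inner ℂ (b j h) (b j h) = ∑ h, ∑ i, star (b j h) * τ.mat h i j * b i 1 := by
          refine Finset.sum_congr rfl fun h _ => ?_
          rw [RCLike.inner_apply]
          nth_rewrite 1 [hcoef h]
          rw [Finset.sum_mul]
          refine Finset.sum_congr rfl fun i _ => ?_
          rw [RCLike.star_def]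
          ring
      _ = 0 := by
          rw [Finset.sum_comm]
          refine Finset.sum_eq_zero fun i _ => ?_
          rw [← Finset.sum_mul, horth, zero_mul]
  exact hb.ne_zero j (inner_self_eq_zero.1 h0)

/-- The Fourier transform is injective. -/
lemma eq_zero_of_forall_sum_smul_mat_eq_zero (f : G → ℂ)
    (hf : ∀ τ : UnitaryIrrep G, ∑ g, f g • τ.mat g = 0) : f = 0 := by
  have h : (WithLp.toLp 2 fun g => star (f g) : EuclideanSpace ℂ G) ∈ fourierKernel G :=
    fun τ => by simpa using hf τ
  rw [fourierKernel_eq_bot, Submodule.mem_bot] at h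
  funext g
  have hg := congrArg (fun f : EuclideanSpace ℂ G => f g) h
  simpa using hg

namespace IsDual

variable {ι : Type*} {σ : ι → UnitaryIrrep G}

/-- The characters of inequivalent irreps are linearly independent functions on `G`. -/
lemma finite (hσ : IsDual σ) : Finite ι := by
  classical
  have hli : LinearIndependent ℂ fun (i : ι) (g : G) => ((σ i).mat g⁻¹).trace := by
    rw [linearIndependent_iff']
    intro s c hc j hj
    have hd : ((σ j).dim : ℂ) ≠ 0 := by exact_mod_cast (σ j).dim_pos.ne'
    have hn : (Fintype.card G : ℂ) ≠ 0 := by exact_mod_cast Fintype.card_ne_zero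
    have hc' : ∀ g, ∑ i ∈ s, c i * ((σ i).mat g⁻¹).trace = 0 := fun g => by
      simpa [Finset.sum_apply] using congrFun hc g
    have h : ∑ i ∈ s, c i • ∑ g, ((σ i).mat g⁻¹).trace • (σ j).mat g = 0 := by
      simp only [Finset.smul_sum, smul_smul]
      rw [Finset.sum_comm]
      simp only [← Finset.sum_smul, hc', zero_smul, Finset.sum_const_zero]
    rw [Finset.sum_eq_single_of_mem j hj fun i _ hij => by
      rw [UnitaryIrrep.sum_trace_smul_mat_of_not_equivalent (hσ.not_equivalent hij), smul_zero],
      UnitaryIrrep.sum_trace_smul_mat_self, smul_smul] at h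
    have h' := congrFun (congrFun h ⟨0, (σ j).dim_pos⟩) ⟨0, (σ j).dim_pos⟩
    simpa [hd, hn] using h'
  exact hli.finite

/-- The decomposition `∑ d_σ χ_σ` of the character of the regular representation. -/
lemma sum_dim_mul_trace [DecidableEq G] [Fintype ι] (hσ : IsDual σ) (g : G) :
    ∑ i, ((σ i).dim : ℂ) * ((σ i).mat g).trace = if g = 1 then (Fintype.card G : ℂ) else 0 := by
  -- The Fourier transform of `f` vanishes at every irrep, by Schur orthogonality.
  let f : G → ℂ := fun g => ∑ i, ((σ i).dim : ℂ) * ((σ i).mat g⁻¹).trace -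
    if g = 1 then (Fintype.card G : ℂ) else 0
  have hj : ∀ j, ∑ g, f g • (σ j).mat g = 0 := by
    intro j
    have hd : ((σ j).dim : ℂ) ≠ 0 := by exact_mod_cast (σ j).dim_pos.ne'
    have h : ∑ i, ((σ i).dim : ℂ) • ∑ g, ((σ i).mat g⁻¹).trace • (σ j).mat g =
        (Fintype.card G : ℂ) • 1 := by
      rw [Finset.sum_eq_single j (fun i _ hij => by
        rw [UnitaryIrrep.sum_trace_smul_mat_of_not_equivalent (hσ.not_equivalent hij), smul_zero])
        (by simp), UnitaryIrrep.sum_trace_smul_mat_self, smul_smul, mul_div_cancel₀ _ hd]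
    simp only [f, sub_smul, Finset.sum_sub_distrib, Finset.sum_smul]
    rw [Finset.sum_comm]
    simp only [mul_smul, ← Finset.smul_sum, h]
    simp [UnitaryIrrep.mat_one]
  have hf : f = 0 := by
    refine eq_zero_of_forall_sum_smul_mat_eq_zero f fun τ => ?_
    obtain ⟨i, hi, -⟩ := hσ τ
    obtain ⟨P, Q, hPQ⟩ := UnitaryIrrep.Equivalent.exists_matrix hi
    have h := congrArg (fun A => P * A * Q) (hj i)
    simpa only [Matrix.mul_sum, Matrix.sum_mul, Matrix.mul_smul, Matrix.smul_mul, ← hPQ,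
      Matrix.mul_zero, Matrix.zero_mul] using h
  have h := congrFun hf g⁻¹
  simpa [f, sub_eq_zero] using h

end IsDual

/-! ### Fourier transform of convolution-type matrices -/

/-- The Fourier coefficient `∑ g, f(g) σ(g⁻¹)` without normalization. -/
def rawCoeff (f : G → ℂ) (σ : UnitaryIrrep G) : Matrix (Fin σ.dim) (Fin σ.dim) ℂ :=
  ∑ g, f g • σ.mat g⁻¹

lemma rawCoeff_conjTranspose (f : G → ℂ) (σ : UnitaryIrrep G) :
    (rawCoeff f σ)ᴴ = rawCoeff (fun g => star (f g⁻¹)) σ := by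
  unfold rawCoeff
  rw [Matrix.conjTranspose_sum, ← Equiv.sum_comp (Equiv.inv G)]
  refine Finset.sum_congr rfl fun g _ => ?_
  simp [Matrix.conjTranspose_smul, UnitaryIrrep.mat_inv]

/-- The Fourier transform takes convolution to the product in reversed order. -/
lemma rawCoeff_mul (f f' : G → ℂ) (σ : UnitaryIrrep G) :
    rawCoeff f σ * rawCoeff f' σ = rawCoeff (fun g => ∑ a, f' a * f (a⁻¹ * g)) σ := by
  unfold rawCoeff
  simp only [Matrix.mul_sum, Matrix.sum_mul, Matrix.smul_mul, Matrix.mul_smul, Finset.sum_smul,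
    ← UnitaryIrrep.mat_mul]
  rw [Finset.sum_comm (s := (Finset.univ : Finset G)) (t := (Finset.univ : Finset G))
    (f := fun g a => (f' a * f (a⁻¹ * g)) • σ.mat g⁻¹)]
  refine Finset.sum_congr rfl fun a _ => ?_
  rw [Finset.smul_sum, ← Equiv.sum_comp (Equiv.mulLeft a) fun g => (f' a * f (a⁻¹ * g)) • σ.mat g⁻¹]
  refine Finset.sum_congr rfl fun b _ => ?_
  rw [Equiv.coe_mulLeft, inv_mul_cancel_left, mul_inv_rev, smul_smul]

lemma IsDual.sum_dim_mul_trace_rawCoeff [DecidableEq G] {ι : Type*} [Fintype ι]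
    {σ : ι → UnitaryIrrep G} (hσ : IsDual σ) (f : G → ℂ) :
    ∑ i, ((σ i).dim : ℂ) * (rawCoeff f (σ i)).trace = Fintype.card G * f 1 := by
  simp only [rawCoeff, Matrix.trace_sum, Matrix.trace_smul, smul_eq_mul, Finset.mul_sum]
  rw [Finset.sum_comm]
  simp only [mul_left_comm _ (f _), ← Finset.mul_sum, hσ.sum_dim_mul_trace]
  simp [mul_comm]

/-- The normalizing factor of the Fourier coefficients at `σ`. -/
def normalization (σ : UnitaryIrrep G) : ℂ :=
  ((Real.sqrt ((σ.dim : ℝ) / (Fintype.card G : ℝ)) : ℝ) : ℂ)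

lemma normalization_ne_zero (σ : UnitaryIrrep G) : normalization σ ≠ 0 := by
  have hd : (0 : ℝ) < σ.dim := by exact_mod_cast σ.dim_pos
  have hn : (0 : ℝ) < Fintype.card G := by exact_mod_cast Fintype.card_pos
  exact Complex.ofReal_ne_zero.2 (Real.sqrt_pos.2 (div_pos hd hn)).ne'

lemma fourierCoeff_eq (f : G → ℂ) (σ : UnitaryIrrep G) :
    fourierCoeff f σ = normalization σ • rawCoeff f σ := rfl

lemma fourierCoeff_conjTranspose (f : G → ℂ) (σ : UnitaryIrrep G) :
    (fourierCoeff f σ)ᴴ = fourierCoeff (fun g => star (f g⁻¹)) σ := by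
  rw [fourierCoeff_eq, fourierCoeff_eq, Matrix.conjTranspose_smul, rawCoeff_conjTranspose]
  simp [normalization]

lemma dim_rpow_mul_normalization_inv (σ : UnitaryIrrep G) :
    ((((σ.dim : ℝ) ^ (3 / 2 : ℝ) : ℝ)) : ℂ) * (normalization σ)⁻¹ =
      ((Real.sqrt (Fintype.card G : ℝ) : ℝ) : ℂ) * σ.dim := by
  have hd : (0 : ℝ) < σ.dim := by exact_mod_cast σ.dim_pos
  have hn : (0 : ℝ) < Fintype.card G := by exact_mod_cast Fintype.card_pos
  have h : (σ.dim : ℝ) ^ (3 / 2 : ℝ) = σ.dim * Real.sqrt σ.dim := by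
    rw [Real.sqrt_eq_rpow, show (3 / 2 : ℝ) = 1 + 1 / 2 by norm_num, Real.rpow_add hd,
      Real.rpow_one]
  have h1 := (Real.sqrt_pos.2 hd).ne'
  have h2 := (Real.sqrt_pos.2 hn).ne'
  rw [normalization, h, Real.sqrt_div hd.le]
  norm_cast
  field_simp

lemma sqrt_card_mul_card_ne_zero :
    ((Real.sqrt (Fintype.card G : ℝ) : ℝ) : ℂ) * Fintype.card G ≠ 0 := by
  have hn : (0 : ℝ) < Fintype.card G := by exact_mod_cast Fintype.card_pos
  exact mul_ne_zero (Complex.ofReal_ne_zero.2 (Real.sqrt_pos.2 hn).ne')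
    (by exact_mod_cast Fintype.card_ne_zero)

section Orbit

variable [DecidableEq G] {X : Type*} [MulAction G X] {k : X → X → ℝ} {x : X}

lemma orbitMatrix_inv_mul_left (hk : IsStationary G k) (g a b : G) :
    (orbitMatrix G k x)⁻¹ (g * a) (g * b) = (orbitMatrix G k x)⁻¹ a b := by
  have h : (orbitMatrix G k x).submatrix (Equiv.mulLeft g) (Equiv.mulLeft g) =
      orbitMatrix G k x := by
    ext a b
    exact orbitMatrix_mul_left hk g a b
  have h' := Matrix.inv_submatrix_equiv (orbitMatrix G k x) (Equiv.mulLeft g) (Equiv.mulLeft g)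
  rw [h] at h'
  exact (congrFun (congrFun h' a) b).symm

/-- The row of the inverse of the orbit matrix indexed by the identity. -/
def inverseRow (G : Type*) [Group G] [Fintype G] [DecidableEq G] {X : Type*} [MulAction G X]
    (k : X → X → ℝ) (x : X) (g : G) : ℂ :=
  (((orbitMatrix G k x)⁻¹ 1 g : ℝ) : ℂ)

/-- By stationarity of `K⁻¹`, the row at `g⁻¹` equals the column at `g`. -/
lemma inverseRow_inv (hk : IsStationary G k) (g : G) :
    inverseRow G k x g⁻¹ = (((orbitMatrix G k x)⁻¹ g 1 : ℝ) : ℂ) := by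
  have h := orbitMatrix_inv_mul_left (x := x) hk g 1 g⁻¹
  rw [mul_one, mul_inv_cancel] at h
  rw [inverseRow, h]

lemma rawCoeff_mul_rawCoeff_inverseRow (hk : IsStationary G k)
    (hK : IsUnit (orbitMatrix G k x)) (σ : UnitaryIrrep G) :
    rawCoeff (fun h : G => ((orbitMatrix G k x 1 h : ℝ) : ℂ)) σ *
      rawCoeff (inverseRow G k x) σ = 1 := by
  have h : (fun g => ∑ a, inverseRow G k x a * ((orbitMatrix G k x 1 (a⁻¹ * g) : ℝ) : ℂ)) =
      fun g : G => if g = 1 then 1 else 0 := by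
    funext g
    have h := congrFun (congrFun
      (Matrix.nonsing_inv_mul _ ((Matrix.isUnit_iff_isUnit_det _).1 hK)) 1) g
    rw [Matrix.mul_apply, Matrix.one_apply] at h
    have h' : ∀ a, orbitMatrix G k x 1 (a⁻¹ * g) = orbitMatrix G k x a g := fun a => by
      rw [← orbitMatrix_mul_left hk a, mul_one, mul_inv_cancel_left]
    simp only [h', inverseRow, eq_comm (a := g)]
    have hc := congrArg (fun r : ℝ => (r : ℂ)) h
    rw [apply_ite Complex.ofReal, Complex.ofReal_one, Complex.ofReal_zero] at hc
    simpa using hc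
  rw [rawCoeff_mul, h]
  simp [rawCoeff, UnitaryIrrep.mat_one]

lemma kernelCoeff_mul (hk : IsStationary G k) (hK : IsUnit (orbitMatrix G k x))
    (σ : UnitaryIrrep G) :
    kernelCoeff k x σ * ((normalization σ)⁻¹ • rawCoeff (inverseRow G k x) σ) = 1 := by
  rw [kernelCoeff, fourierCoeff_eq, Matrix.smul_mul, Matrix.mul_smul, smul_smul,
    mul_inv_cancel₀ (normalization_ne_zero σ), one_smul, rawCoeff_mul_rawCoeff_inverseRow hk hK]

lemma kernelCoeff_inv (hk : IsStationary G k) (hK : IsUnit (orbitMatrix G k x))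
    (σ : UnitaryIrrep G) :
    (kernelCoeff k x σ)⁻¹ = (normalization σ)⁻¹ • rawCoeff (inverseRow G k x) σ :=
  Matrix.inv_eq_right_inv (kernelCoeff_mul hk hK σ)

variable {ι : Type*} [Fintype ι] {σ : ι → UnitaryIrrep G}

lemma sum_trace_kernelCoeff_inv (hk : IsStationary G k) (hK : IsUnit (orbitMatrix G k x))
    (hσ : IsDual σ) :
    ∑ i, ((((σ i).dim : ℝ) ^ (3 / 2 : ℝ) : ℝ) : ℂ) * ((kernelCoeff k x (σ i))⁻¹).trace =
      ((Real.sqrt (Fintype.card G : ℝ) : ℝ) : ℂ) *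
        (Fintype.card G * (((orbitMatrix G k x)⁻¹ 1 1 : ℝ) : ℂ)) := by
  have h := hσ.sum_dim_mul_trace_rawCoeff (inverseRow G k x)
  rw [inverseRow] at h
  rw [← h, Finset.mul_sum]
  refine Finset.sum_congr rfl fun i _ => ?_
  rw [kernelCoeff_inv hk hK, Matrix.trace_smul, smul_eq_mul, ← mul_assoc,
    dim_rpow_mul_normalization_inv, mul_assoc]

lemma sum_trace_kernelCoeff_inv_mul (hk : IsStationary G k)
    (hK : IsUnit (orbitMatrix G k x)) (hσ : IsDual σ) (f : G → ℂ) :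
    ∑ i, ((σ i).dim : ℂ) * ((kernelCoeff k x (σ i))⁻¹ * fourierCoeff f (σ i)).trace =
      Fintype.card G * ∑ g, (((orbitMatrix G k x)⁻¹ g 1 : ℝ) : ℂ) * f g := by
  have h := hσ.sum_dim_mul_trace_rawCoeff
    (fun g => ∑ a, f a * inverseRow G k x (a⁻¹ * g))
  simp only [← rawCoeff_mul, mul_one, inverseRow_inv hk] at h
  simp only [mul_comm _ (f _)]
  rw [← h]
  refine Finset.sum_congr rfl fun i _ => ?_
  rw [kernelCoeff_inv hk hK, fourierCoeff_eq, Matrix.smul_mul, Matrix.mul_smul, smul_smul,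
    inv_mul_cancel₀ (normalization_ne_zero _), one_smul]

end Orbit

end

/-! ### The spectral formula for the error -/

section

variable {G X ι : Type*} [Group G] [Fintype G] [DecidableEq G] [MulAction G X] [Fintype ι]
  {k : X → X → ℝ} {x : X} {σ : ι → UnitaryIrrep G}

lemma sum_trace_kernelCoeff_inv_ne_zero (hk : IsStationary G k)
    (hK : (orbitMatrix G k x).PosDef) (hσ : IsDual σ) :
    ∑ i, ((((σ i).dim : ℝ) ^ (3 / 2 : ℝ) : ℝ) : ℂ) * ((kernelCoeff k x (σ i))⁻¹).trace ≠ 0 := by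
  rw [sum_trace_kernelCoeff_inv hk hK.isUnit hσ, ← mul_assoc]
  exact mul_ne_zero sqrt_card_mul_card_ne_zero (Complex.ofReal_ne_zero.2 hK.inv.diag_pos.ne')

lemma predictionError_eq_spectral (hk : IsStationary G k) (hK : (orbitMatrix G k x).PosDef)
    (hσ : IsDual σ) (y : G → ℂ) :
    predictionError k x y =
      -(((Real.sqrt (Fintype.card G : ℝ) : ℝ) : ℂ) *
          ∑ i, ((σ i).dim : ℂ) * ((kernelCoeff k x (σ i))⁻¹ * fourierCoeff y (σ i)).trace) /
        ∑ i, ((((σ i).dim : ℝ) ^ (3 / 2 : ℝ) : ℝ) : ℂ) * ((kernelCoeff k x (σ i))⁻¹).trace := by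
  rw [sum_trace_kernelCoeff_inv hk hK.isUnit hσ, sum_trace_kernelCoeff_inv_mul hk hK.isUnit hσ,
    predictionError_eq hK, ← mul_assoc, ← mul_assoc, ← mul_neg,
    mul_div_mul_left _ _ sqrt_card_mul_card_ne_zero]

lemma conj_predictionError (hK : (orbitMatrix G k x).PosDef) (y : G → ℂ) :
    (starRingEnd ℂ) (predictionError k x y) = predictionError k x (star y) := by
  rw [predictionError_eq hK, predictionError_eq hK]
  simp

/-- Taking adjoints of the coefficients of `y` amounts to replacing `y(g)` by the conjugate of
`y(g⁻¹)`; the inversion is harmless because the inverse of the kernel matrix is symmetric. -/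
lemma sum_trace_kernelCoeff_inv_mul_conjTranspose (hk : IsStationary G k)
    (hK : (orbitMatrix G k x).PosDef) (hσ : IsDual σ) (y : G → ℂ) :
    ∑ i, ((σ i).dim : ℂ) * ((kernelCoeff k x (σ i))⁻¹ * (fourierCoeff y (σ i))ᴴ).trace =
      ∑ i, ((σ i).dim : ℂ) * ((kernelCoeff k x (σ i))⁻¹ * fourierCoeff (star y) (σ i)).trace := by
  simp only [fourierCoeff_conjTranspose]
  rw [sum_trace_kernelCoeff_inv_mul hk hK.isUnit hσ, sum_trace_kernelCoeff_inv_mul hk hK.isUnit hσ,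
    ← Equiv.sum_comp (Equiv.inv G)]
  congr 1
  refine Finset.sum_congr rfl fun g _ => ?_
  rw [Equiv.inv_apply, inv_inv, ← inverseRow_inv hk, inv_inv, inverseRow,
    orbitMatrix_inv_comm hK, Pi.star_apply]

end

end GroupKernel

end

/-- The spectral error of kernel regression on an orbit of a finite group, with the label at the
identity missing. -/
theorem theorem15 {G X H ι : Type*} [Group G] [Fintype G] [DecidableEq G] [MulAction G X]
    [NormedAddCommGroup H] [InnerProductSpace ℝ H]
    (k : X → X → ℝ) (φ : X → H) (hφ : GroupKernel.IsFeatureMap k φ)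
    (hk : GroupKernel.IsStationary G k) (x : X)
    (hK : IsUnit (GroupKernel.orbitMatrix G k x))
    (σ : ι → GroupKernel.UnitaryIrrep G) (hσ : GroupKernel.IsDual σ) (y : G → ℂ) :
    -- all objects in the formula are well defined
    Finite ι ∧
    IsUnit (GroupKernel.kernelMatrix k (GroupKernel.trainPoint (G := G) x)) ∧
    (∀ i, IsUnit (GroupKernel.kernelCoeff k x (σ i))) ∧
    (∑ᶠ i, ((((σ i).dim : ℝ) ^ (3 / 2 : ℝ) : ℝ) : ℂ) *
        ((GroupKernel.kernelCoeff k x (σ i))⁻¹).trace) ≠ 0 ∧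
    -- the error of kernel regression is the unique most likely error
    (∀ z : ℂ, z ≠ GroupKernel.predictionError k x y →
      GroupKernel.likelihood (GroupKernel.orbitMatrix G k x) (y + Pi.single 1 z) <
        GroupKernel.likelihood (GroupKernel.orbitMatrix G k x)
          (y + Pi.single 1 (GroupKernel.predictionError k x y))) ∧
    -- the formula for complex labels
    GroupKernel.predictionError k x y =
      -(((Real.sqrt (Fintype.card G : ℝ) : ℝ) : ℂ) *
          ∑ᶠ i, ((σ i).dim : ℂ) * ((GroupKernel.kernelCoeff k x (σ i))⁻¹ *
            GroupKernel.fourierCoeff y (σ i)).trace) /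
        (∑ᶠ i, ((((σ i).dim : ℝ) ^ (3 / 2 : ℝ) : ℝ) : ℂ) *
          ((GroupKernel.kernelCoeff k x (σ i))⁻¹).trace) ∧
    -- the formula with the adjoint coefficients of the labels gives the conjugate error
    (starRingEnd ℂ) (GroupKernel.predictionError k x y) =
      -(((Real.sqrt (Fintype.card G : ℝ) : ℝ) : ℂ) *
          ∑ᶠ i, ((σ i).dim : ℂ) * ((GroupKernel.kernelCoeff k x (σ i))⁻¹ *
            (GroupKernel.fourierCoeff y (σ i))ᴴ).trace) /
        (∑ᶠ i, ((((σ i).dim : ℝ) ^ (3 / 2 : ℝ) : ℝ) : ℂ) *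
          ((GroupKernel.kernelCoeff k x (σ i))⁻¹).trace) ∧
    -- the formula with the adjoint coefficients for real labels
    ((∀ g, (y g).im = 0) →
      GroupKernel.predictionError k x y =
        -(((Real.sqrt (Fintype.card G : ℝ) : ℝ) : ℂ) *
            ∑ᶠ i, ((σ i).dim : ℂ) * ((GroupKernel.kernelCoeff k x (σ i))⁻¹ *
              (GroupKernel.fourierCoeff y (σ i))ᴴ).trace) /
          (∑ᶠ i, ((((σ i).dim : ℝ) ^ (3 / 2 : ℝ) : ℝ) : ℂ) *
            ((GroupKernel.kernelCoeff k x (σ i))⁻¹).trace)) := by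
  have hP := GroupKernel.orbitMatrix_posDef hφ hK
  have hfin : Finite ι := hσ.finite
  cases nonempty_fintype ι
  simp only [finsum_eq_sum_of_fintype]
  have hconj : (starRingEnd ℂ) (GroupKernel.predictionError k x y) =
      -(((Real.sqrt (Fintype.card G : ℝ) : ℝ) : ℂ) *
          ∑ i, ((σ i).dim : ℂ) * ((GroupKernel.kernelCoeff k x (σ i))⁻¹ *
            (GroupKernel.fourierCoeff y (σ i))ᴴ).trace) /
        (∑ i, ((((σ i).dim : ℝ) ^ (3 / 2 : ℝ) : ℝ) : ℂ) *
          ((GroupKernel.kernelCoeff k x (σ i))⁻¹).trace) := by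
    rw [GroupKernel.sum_trace_kernelCoeff_inv_mul_conjTranspose hk hP hσ,
      GroupKernel.conj_predictionError hP, GroupKernel.predictionError_eq_spectral hk hP hσ]
  refine ⟨hfin, GroupKernel.kernelMatrix_trainPoint_isUnit hP,
    fun i => IsUnit.of_mul_eq_one _ (GroupKernel.kernelCoeff_mul hk hK (σ i)),
    GroupKernel.sum_trace_kernelCoeff_inv_ne_zero hk hP hσ,
    fun z hz => GroupKernel.likelihood_predictionError hP y z hz,
    GroupKernel.predictionError_eq_spectral hk hP hσ y, hconj, fun hy => ?_⟩
  have hstar : star y = y := funext fun g => Complex.conj_eq_iff_im.2 (hy g)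
  rw [← hconj, GroupKernel.conj_predictionError hP, hstar]
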